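/- Let $\ell,T,h,\theta>0$ and let $\rho_A,\mu,r,\kappa\in L^\infty(0,\ell)$ satisfy, for almost every $x\in(0,\ell)$, $$0<\rho_0\le\rho_A(x)\le\rho_1,\quad 0\le\mu_0\le\mu(x)\le\mu_1,\quad 0<r_0\le r(x)\le r_1,\quad 0<\kappa_0\le\kappa(x)\le\kappa_1$$ with constants $\rho_i,\mu_i,r_i,\kappa_i$. Let $C_g>0$, let $\mathcal G=\{g\in H^1(0,T): g(0)=0,\ \|g\|_{H^1(0,T)}\le C_g\}$, and let $\nu\in L^2(0,T)$. For $g\in\mathcal G$ put $M(t)=\frac{2h\cos\theta}{\pi}g(t)$ and consider the problem $$\rho_A u_{tt}+\mu u_t+(r u_{xx}+\kappa u_{xxt})_{xx}=0\ \text{ in }(0,\ell)\times(0,T),\qquad u(x,0)=u_t(x,0)=0,$$ $$u(0,t)=u_x(0,t)=0,\quad (r u_{xx}+\kappa u_{xxt})|_{x=\ell}=M(t),\quad -(r u_{xx}+\kappa u_{xxt})_x|_{x=\ell}=g(t).$$ Let $V=\{v\in H^2(0,\ell): v(0)=v'(0)=0\}$. A weak solution is a function $u$ with $u,u_t\in L^2(0,T;V)$,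 $\rho_A u_{tt}:=(\rho_A u_t)_t\in L^2(0,T;V^*)$ (where $\rho_A u_t$ is regarded as the functional $v\mapsto\int_0^\ell\rho_A u_t v\,dx$ on $V$), with $u=0$ and $\rho_A u_t=0$ at $t=0$, such that for almost every $t\in(0,T)$ and all $v\in V$ $$\langle\rho_A u_{tt},v\rangle+\int_0^\ell\mu u_t v\,dx+\int_0^\ell(r u_{xx}+\kappa u_{xxt})v_{xx}\,dx=M(t)v_x(\ell)+g(t)v(\ell).$$ Then for every $g\in\mathcal G$ there is exactly one weak solution $u(\cdot,\cdot;g)$, and its output $u(\ell,\cdot;g)$ belongs to $L^2(0,T)$, so that the functional $J(g)=\frac12\|u(\ell,\cdot;g)-\nu\|^2_{L^2(0,T)}$ is well defined on $\mathcal G$. Moreover a quasi-solution of the inverse problem of recovering $g$ from $\nu$ exists: there is $g\in\mathcal G$ with $J(g)=\min_{\tilde g\in\mathcal G}J(\tilde g)$. -/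

import Mathlib

open MeasureTheory Set
open scoped ContDiff

noncomputable section

namespace AFM

/-! ## Function spaces on a bounded interval -/

/-- Lebesgue measure on the open interval `(a, b)`. -/
abbrev volIoo (a b : ℝ) : Measure ℝ := volume.restrict (Ioo a b)

/-- The (Bochner) space `L²(a, b; E)`. -/
abbrev L2 (a b : ℝ) (E : Type*) [NormedAddCommGroup E] : Type _ := Lp E 2 (volIoo a b)

section PointValues

variable {E : Type*} [NormedAddCommGroup E]

/-- `c` is the value at `x` of the continuous representative of `f` on `[a, b]`. -/
def HasValueAt (a b : ℝ) (f : ℝ → E) (x : ℝ) (c : E) : Prop :=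
  ∃ f₀ : ℝ → E, ContinuousOn f₀ (Icc a b) ∧ f =ᵐ[volIoo a b] f₀ ∧ f₀ x = c

/-- The value at `x` of the continuous representative of `f` on `[a, b]`
(meaningful when there is one, `a < b` and `x ∈ [a, b]`). -/
def valueAt (a b : ℝ) (f : ℝ → E) (x : ℝ) : E :=
  Classical.epsilon fun c => HasValueAt a b f x c

theorem HasValueAt.zero (a b x : ℝ) : HasValueAt a b (0 : L2 a b E) x 0 :=
  ⟨fun _ => 0, continuousOn_const, Lp.coeFn_zero E 2 (volIoo a b), rfl⟩

theorem HasValueAt.add {a b x : ℝ} {f g : L2 a b E} {c d : E} (hf : HasValueAt a b f x c)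
    (hg : HasValueAt a b g x d) : HasValueAt a b (f + g : L2 a b E) x (c + d) := by
  obtain ⟨f₀, h1, h2, h3⟩ := hf
  obtain ⟨g₀, k1, k2, k3⟩ := hg
  refine ⟨fun y => f₀ y + g₀ y, h1.add k1, ?_, by simp [h3, k3]⟩
  filter_upwards [Lp.coeFn_add f g, h2, k2] with y hy hy1 hy2
  rw [hy, Pi.add_apply, hy1, hy2]

theorem HasValueAt.smul [NormedSpace ℝ E] {a b x : ℝ} {f : L2 a b E} {d : E} (c : ℝ)
    (hf : HasValueAt a b f x d) : HasValueAt a b (c • f : L2 a b E) x (c • d) := by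
  obtain ⟨f₀, h1, h2, h3⟩ := hf
  refine ⟨fun y => c • f₀ y, h1.const_smul c, ?_, by simp [h3]⟩
  filter_upwards [Lp.coeFn_smul c f, h2] with y hy hy1
  rw [hy, Pi.smul_apply, hy1]

end PointValues

section WeakDeriv

variable {E : Type*} [NormedAddCommGroup E] [NormedSpace ℝ E]

/-- `f'` is the weak derivative of `f` on `(a, b)`: `∫ φ' f = - ∫ φ f'` for every test function
`φ ∈ C_c^∞(a, b)`. It is only used for `f, f' ∈ L²(a, b; E)` with `E` a Banach space. -/
def HasWeakDeriv (a b : ℝ) (f f' : ℝ → E) : Prop :=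
  ∀ φ : ℝ → ℝ, ContDiff ℝ ∞ φ → HasCompactSupport φ → tsupport φ ⊆ Ioo a b →
    ∫ x in Ioo a b, deriv φ x • f x = - ∫ x in Ioo a b, φ x • f' x

theorem integrable_smul_L2 {a b : ℝ} {ψ : ℝ → ℝ} (hψ : Continuous ψ) (hc : HasCompactSupport ψ)
    (f : L2 a b E) : Integrable (fun x => ψ x • f x) (volIoo a b) := by
  obtain ⟨C, hC⟩ := hc.exists_bound_of_continuous hψ
  have hf : Integrable f (volIoo a b) := (Lp.memLp f).integrable (by norm_num)
  exact hf.bdd_smul C hψ.aestronglyMeasurable (Filter.Eventually.of_forall hC)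

theorem integral_smul_zero {a b : ℝ} (ψ : ℝ → ℝ) :
    ∫ x in Ioo a b, ψ x • (0 : L2 a b E) x = 0 := by
  rw [← integral_zero ℝ E (μ := volIoo a b)]
  apply integral_congr_ae
  filter_upwards [Lp.coeFn_zero E 2 (volIoo a b)] with x hx
  rw [hx, Pi.zero_apply, smul_zero]

theorem integral_smul_add {a b : ℝ} {ψ : ℝ → ℝ} (hψ : Continuous ψ) (hc : HasCompactSupport ψ)
    (f g : L2 a b E) : ∫ x in Ioo a b, ψ x • (f + g : L2 a b E) x
      = (∫ x in Ioo a b, ψ x • f x) + ∫ x in Ioo a b, ψ x • g x := by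
  rw [← integral_add (integrable_smul_L2 hψ hc f) (integrable_smul_L2 hψ hc g)]
  apply integral_congr_ae
  filter_upwards [Lp.coeFn_add f g] with x hx
  rw [hx, Pi.add_apply, smul_add]

theorem integral_smul_smul {a b : ℝ} (ψ : ℝ → ℝ) (c : ℝ) (f : L2 a b E) :
    ∫ x in Ioo a b, ψ x • (c • f : L2 a b E) x = c • ∫ x in Ioo a b, ψ x • f x := by
  rw [← integral_smul]
  apply integral_congr_ae
  filter_upwards [Lp.coeFn_smul c f] with x hx
  rw [hx, Pi.smul_apply, smul_comm]

theorem HasWeakDeriv.zero (a b : ℝ) : HasWeakDeriv a b (0 : L2 a b E) (0 : L2 a b E) := by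
  intro φ _ _ _
  rw [integral_smul_zero, integral_smul_zero, neg_zero]

theorem HasWeakDeriv.add {a b : ℝ} {f f' g g' : L2 a b E} (hf : HasWeakDeriv a b f f')
    (hg : HasWeakDeriv a b g g') :
    HasWeakDeriv a b (f + g : L2 a b E) (f' + g' : L2 a b E) := by
  intro φ h1 h2 h3
  rw [integral_smul_add (h1.continuous_deriv (by norm_num)) h2.deriv,
    integral_smul_add h1.continuous h2, hf φ h1 h2 h3, hg φ h1 h2 h3, neg_add]

theorem HasWeakDeriv.smul {a b : ℝ} {f f' : L2 a b E} (c : ℝ) (hf : HasWeakDeriv a b f f') :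
    HasWeakDeriv a b (c • f : L2 a b E) (c • f' : L2 a b E) := by
  intro φ h1 h2 h3
  rw [integral_smul_smul, integral_smul_smul, hf φ h1 h2 h3, smul_neg]

end WeakDeriv

/-- The Sobolev space `H¹(a, b)`, as the space of pairs `(g, g')` with `g, g' ∈ L²(a, b)`, `g'` the
weak derivative of `g`, and the norm `(‖g‖² + ‖g'‖²)^(1/2)`. -/
def H1 (a b : ℝ) : Submodule ℝ (WithLp 2 (L2 a b ℝ × L2 a b ℝ)) where
  carrier := {p | HasWeakDeriv a b p.fst p.snd}
  zero_mem' := HasWeakDeriv.zero a b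
  add_mem' hp hq := HasWeakDeriv.add hp hq
  smul_mem' c _ hp := HasWeakDeriv.smul c hp

/-- The Sobolev space `H²(a, b)`, as the space of triples `(v, v', v'')` in `L²(a, b)` of a function
with its first two weak derivatives, with the norm `(‖v‖² + ‖v'‖² + ‖v''‖²)^(1/2)`. -/
def H2 (a b : ℝ) : Submodule ℝ (PiLp 2 fun _ : Fin 3 => L2 a b ℝ) where
  carrier := {p | HasWeakDeriv a b (p 0) (p 1) ∧ HasWeakDeriv a b (p 1) (p 2)}
  zero_mem' := ⟨HasWeakDeriv.zero a b, HasWeakDeriv.zero a b⟩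
  add_mem' hp hq := ⟨hp.1.add hq.1, hp.2.add hq.2⟩
  smul_mem' c _ hp := ⟨hp.1.smul c, hp.2.smul c⟩

/-- The energy space `{v ∈ H²(0, ℓ) : v(0) = v'(0) = 0}` of a beam clamped at `x = 0`. -/
def clampedH2 (ℓ : ℝ) : Submodule ℝ (PiLp 2 fun _ : Fin 3 => L2 0 ℓ ℝ) where
  carrier := {p | p ∈ H2 0 ℓ ∧ HasValueAt 0 ℓ (p 0) 0 0 ∧ HasValueAt 0 ℓ (p 1) 0 0}
  zero_mem' := ⟨(H2 0 ℓ).zero_mem, HasValueAt.zero 0 ℓ 0, HasValueAt.zero 0 ℓ 0⟩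
  add_mem' hp hq := ⟨(H2 0 ℓ).add_mem hp.1 hq.1,
    by simpa using hp.2.1.add hq.2.1, by simpa using hp.2.2.add hq.2.2⟩
  smul_mem' c _ hp := ⟨(H2 0 ℓ).smul_mem c hp.1,
    by simpa using hp.2.1.smul c, by simpa using hp.2.2.smul c⟩

/-- The clamped energy space as a type, with the `H²` norm. -/
abbrev V (ℓ : ℝ) : Type := clampedH2 ℓ

namespace V

variable {ℓ : ℝ}

/-- The function `v` itself. -/
def fn (v : V ℓ) : L2 0 ℓ ℝ := v.1 0

/-- The first derivative `v_x`. -/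
def dx (v : V ℓ) : L2 0 ℓ ℝ := v.1 1

/-- The second derivative `v_xx`. -/
def dxx (v : V ℓ) : L2 0 ℓ ℝ := v.1 2

/-- The tip value `v(ℓ)`. -/
def tip (v : V ℓ) : ℝ := valueAt 0 ℓ v.fn ℓ

/-- The tip slope `v_x(ℓ)`. -/
def tipSlope (v : V ℓ) : ℝ := valueAt 0 ℓ v.dx ℓ

end V

/-! ## The direct problem -/

/-- Data of the beam model: length `ℓ`, final time `T`, tip length `h`, half-conic angle `θ`, and
the coefficients `ρ_A`, `μ`, `r`, `κ` (only their values on `(0, ℓ)` matter). -/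
structure Model where
  ℓ : ℝ
  T : ℝ
  h : ℝ
  θ : ℝ
  ρA : ℝ → ℝ
  μ : ℝ → ℝ
  r : ℝ → ℝ
  κ : ℝ → ℝ

namespace Model

/-- The basic conditions on the geometry and on the coefficients. -/
structure BasicConditions (B : Model) : Prop where
  ℓ_pos : 0 < B.ℓ
  T_pos : 0 < B.T
  h_pos : 0 < B.h
  θ_pos : 0 < B.θ
  ρA_mem : MemLp B.ρA ⊤ (volIoo 0 B.ℓ)
  μ_mem : MemLp B.μ ⊤ (volIoo 0 B.ℓ)
  r_mem : MemLp B.r ⊤ (volIoo 0 B.ℓ)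
  κ_mem : MemLp B.κ ⊤ (volIoo 0 B.ℓ)
  ρA_bounds : ∃ ρ₀ ρ₁ : ℝ, 0 < ρ₀ ∧ ∀ᵐ x ∂volIoo 0 B.ℓ, ρ₀ ≤ B.ρA x ∧ B.ρA x ≤ ρ₁
  μ_bounds : ∃ μ₀ μ₁ : ℝ, 0 ≤ μ₀ ∧ ∀ᵐ x ∂volIoo 0 B.ℓ, μ₀ ≤ B.μ x ∧ B.μ x ≤ μ₁
  r_bounds : ∃ r₀ r₁ : ℝ, 0 < r₀ ∧ ∀ᵐ x ∂volIoo 0 B.ℓ, r₀ ≤ B.r x ∧ B.r x ≤ r₁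
  κ_bounds : ∃ κ₀ κ₁ : ℝ, 0 < κ₀ ∧ ∀ᵐ x ∂volIoo 0 B.ℓ, κ₀ ≤ B.κ x ∧ B.κ x ≤ κ₁

variable (B : Model)

/-- The moment `M(t) = (2 h cos θ / π) g(t)` generated by the shear force `g`. -/
def moment (g : ℝ → ℝ) (t : ℝ) : ℝ := 2 * B.h * Real.cos B.θ / Real.pi * g t

/-- `u ∈ L²(0, T; V)` is the weak solution of
`ρ_A u_tt + μ u_t + (r u_xx + κ u_xxt)_xx = 0` with `u = u_t = 0` at `t = 0`, `u = u_x = 0` at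
`x = 0`, `r u_xx + κ u_xxt = M` and `-(r u_xx + κ u_xxt)_x = g` at `x = ℓ`:

* `u_t ∈ L²(0, T; V)`, and `u(0) = 0`;
* `ρ_A u_t`, regarded as the functional `v ↦ ∫ ρ_A u_t v` on `V`, has a weak time derivative
  `ρ_A u_tt ∈ L²(0, T; V*)`, and `ρ_A u_t` vanishes at `t = 0` (as `ρ_A > 0` is independent of `t`,
  this is the initial condition `u_t = 0`);
* for almost every `t`, the equation tested with any `v ∈ V` holds. -/
def IsWeakSolution (g : ℝ → ℝ) (u : L2 0 B.T (V B.ℓ)) : Prop :=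
  ∃ (ut : L2 0 B.T (V B.ℓ)) (p pt : L2 0 B.T (StrongDual ℝ (V B.ℓ))),
    HasWeakDeriv 0 B.T u ut ∧
    HasValueAt 0 B.T u 0 0 ∧
    (∀ᵐ t ∂volIoo 0 B.T, ∀ v : V B.ℓ,
      p t v = ∫ x in Ioo 0 B.ℓ, B.ρA x * (ut t).fn x * v.fn x) ∧
    HasWeakDeriv 0 B.T p pt ∧
    HasValueAt 0 B.T p 0 0 ∧
    ∀ᵐ t ∂volIoo 0 B.T, ∀ v : V B.ℓ,
      pt t v + (∫ x in Ioo 0 B.ℓ, B.μ x * (ut t).fn x * v.fn x)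
        + (∫ x in Ioo 0 B.ℓ, (B.r x * (u t).dxx x + B.κ x * (ut t).dxx x) * v.dxx x)
      = B.moment g t * v.tipSlope + g t * v.tip

/-! ## The inverse problem -/

/-- The set of admissible shear forces: `g ∈ H¹(0, T)`, `g(0) = 0`, `‖g‖_{H¹(0,T)} ≤ C_g`. -/
def admissible (Cg : ℝ) : Set (H1 0 B.T) :=
  {g | HasValueAt 0 B.T g.1.fst 0 0 ∧ ‖g‖ ≤ Cg}

/-- The weak solution `u(·, ·; g)` of the direct problem. -/
def solution (g : H1 0 B.T) : L2 0 B.T (V B.ℓ) :=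
  Classical.epsilon fun u => B.IsWeakSolution g.1.fst u

/-- The output `(Ψ g)(t) = u(ℓ, t; g)`. -/
def output (g : H1 0 B.T) (t : ℝ) : ℝ := (B.solution g t).tip

/-- The functional `J(g) = ½ ‖u(ℓ, ·; g) - ν‖²_{L²(0,T)}`. -/
def J (ν : L2 0 B.T ℝ) (g : H1 0 B.T) : ℝ :=
  1 / 2 * ∫ t in Ioo 0 B.T, (B.output g t - ν t) ^ 2

/-- `g` is a quasi-solution: `g ∈ 𝒢` and `J(g)` is the minimum of `J` on `𝒢`. -/
def IsQuasiSolution (Cg : ℝ) (ν : L2 0 B.T ℝ) (g : H1 0 B.T) : Prop :=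
  g ∈ B.admissible Cg ∧ IsMinOn (B.J ν) (B.admissible Cg) g

end Model

end AFM

end

open MeasureTheory Set
open scoped ContDiff

noncomputable section

namespace AFM

/-! ### Primitives in `L²(a, b; E)` and Fubini on the triangle -/

section Primitive

variable {E F G : Type*} [NormedAddCommGroup E] [NormedSpace ℝ E] [NormedAddCommGroup F]
  [NormedSpace ℝ F] [NormedAddCommGroup G] [NormedSpace ℝ G] {a b : ℝ}

/-! By Riesz, the beam equation is an equation `(C u')' + A u' + R u = f` in the Hilbert space `V`,
with `C` the inertia, `A` the damping and `R` the stiffness operator. Let `I` be integration in time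
from 0 on `X = L²(0, T; V)`. An `L²` function has a given weak derivative and vanishes at the left
end exactly when it is the primitive of that derivative (`hasWeakDeriv_and_hasValueAt_iff`, which
rests on du Bois-Reymond). Hence weak solutions are the functions `u = I w` with `C w + I A w + I R
I w = I f` (`weakFormulation_iff`).

Two facts make this equation solvable. The Kelvin-Voigt term makes `A` coercive on `V`, because `κ ≥
κ₀ > 0` and `v_xx` controls the whole `H²` norm of a clamped `v`. For a symmetric nonnegative `S` on
`V`, the integral of `(S f, I f)` is half the value of `(S m, m)` at `m = ∫ f`, so it is nonnegative
(`inner_prim_nonneg`). Testing with `I w` therefore gives `α ‖I w‖ ≤ ‖I f‖`, and with it uniqueness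
and a bound. The same computation for the adjoint of `Q = C + I A + I R I` gives `α ‖I† η‖ ≤ ‖Q†
η‖`, and by Hahn-Banach this places the range of `I` inside that of `Q`, which is existence.

The output is thus a bounded linear function of `g` in `L²(0, T)`, and `J` is a least squares
functional. Parametrized by `d = g'`, the admissible set is nonempty, bounded, closed and convex in
a Hilbert space, so the minimum is attained (`exists_isMinOn_norm_sub`). -/

theorem L2.integrable {E : Type*} [NormedAddCommGroup E] {a b : ℝ} (f : L2 a b E) : Integrable f (volIoo a b) :=
  (Lp.memLp f).integrable (by norm_num)

theorem L2.exists_integral_norm_le (a b : ℝ) (E : Type*) [NormedAddCommGroup E] :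
    ∃ c : ℝ, 0 ≤ c ∧ ∀ f : L2 a b E, ∫ t in Ioo a b, ‖f t‖ ≤ c * ‖f‖ := by
  set K : ENNReal := volIoo a b univ ^ (1 / (1 : ENNReal).toReal - 1 / (2 : ENNReal).toReal)
  have hK : K ≠ ⊤ := ENNReal.rpow_ne_top_of_nonneg (by norm_num) (measure_ne_top _ _)
  refine ⟨K.toReal, ENNReal.toReal_nonneg, fun f => ?_⟩
  have h := eLpNorm_le_eLpNorm_mul_rpow_measure_univ (p := 1) (q := 2) (by norm_num)
    (Lp.aestronglyMeasurable f)
  rw [integral_norm_eq_lintegral_enorm (Lp.aestronglyMeasurable f), ← eLpNorm_one_eq_lintegral_enorm,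
    Lp.norm_def, mul_comm, ← ENNReal.toReal_mul]
  exact ENNReal.toReal_mono (ENNReal.mul_ne_top (Lp.eLpNorm_ne_top f) hK) h

/-- The primitive `t ↦ ∫_{(a, t]} f` of a function on `(a, b)`. -/
def primFn (a b : ℝ) (f : ℝ → E) (t : ℝ) : E := ∫ s in Iic t, f s ∂volIoo a b

theorem continuous_primFn {f : ℝ → E} (hf : Integrable f (volIoo a b)) :
    Continuous (primFn a b f) := by
  have h : primFn a b f = fun t => (∫ s in a..t, f s ∂volIoo a b) + primFn a b f a := by
    funext t
    rw [← intervalIntegral.integral_Iic_sub_Iic hf.integrableOn hf.integrableOn]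
    simp [primFn]
  rw [h]
  exact (intervalIntegral.continuous_primitive (fun _ _ => hf.intervalIntegrable) a).add
    continuous_const

theorem primFn_left (f : ℝ → E) : primFn a b f a = 0 := by
  have h : (volIoo a b).restrict (Iic a) = 0 := by
    rw [volIoo, Measure.restrict_restrict measurableSet_Iic]
    convert Measure.restrict_empty
    ext x
    simp only [mem_inter_iff, mem_Iic, mem_Ioo, mem_empty_iff_false, iff_false]
    rintro ⟨h1, h2, _⟩
    linarith
  rw [primFn, h, integral_zero_measure]

theorem primFn_right (f : ℝ → E) : primFn a b f b = ∫ s in Ioo a b, f s := by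
  rw [primFn, volIoo, Measure.restrict_restrict measurableSet_Iic,
    inter_eq_self_of_subset_right (fun x hx => hx.2.le)]

theorem norm_primFn_le {f : ℝ → E} (hf : Integrable f (volIoo a b)) (t : ℝ) :
    ‖primFn a b f t‖ ≤ ∫ s in Ioo a b, ‖f s‖ :=
  (norm_integral_le_integral_norm _).trans
    (setIntegral_le_integral hf.norm (Filter.Eventually.of_forall fun _ => norm_nonneg _))

theorem memLp_primFn {f : ℝ → E} (hf : Integrable f (volIoo a b)) :
    MemLp (primFn a b f) 2 (volIoo a b) :=
  MemLp.of_bound (continuous_primFn hf).aestronglyMeasurable _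
    (Filter.Eventually.of_forall (norm_primFn_le hf))

theorem primFn_congr {f g : ℝ → E} (h : f =ᵐ[volIoo a b] g) : primFn a b f = primFn a b g :=
  funext fun _ => integral_congr_ae (ae_restrict_of_ae h)

theorem primFn_add {f g : ℝ → E} (hf : Integrable f (volIoo a b))
    (hg : Integrable g (volIoo a b)) : primFn a b (f + g) = primFn a b f + primFn a b g :=
  funext fun _ => integral_add hf.integrableOn hg.integrableOn

theorem primFn_smul (c : ℝ) (f : ℝ → E) : primFn a b (c • f) = c • primFn a b f :=
  funext fun _ => integral_smul c _

/-- Primitives vanishing at `a`, as a linear map. -/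
def primₗ (a b : ℝ) (E : Type*) [NormedAddCommGroup E] [NormedSpace ℝ E] :
    L2 a b E →ₗ[ℝ] L2 a b E where
  toFun f := (memLp_primFn (L2.integrable f)).toLp
  map_add' f g := by
    rw [← MemLp.toLp_add]
    congr 1
    rw [primFn_congr (Lp.coeFn_add f g), primFn_add (L2.integrable f) (L2.integrable g)]
  map_smul' c f := by
    rw [RingHom.id_apply, ← MemLp.toLp_const_smul]
    congr 1
    rw [primFn_congr (Lp.coeFn_smul c f), primFn_smul]

theorem coeFn_primₗ (f : L2 a b E) : primₗ a b E f =ᵐ[volIoo a b] primFn a b f :=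
  MemLp.coeFn_toLp (memLp_primFn (L2.integrable f))

theorem primₗ_bound (a b : ℝ) (E : Type*) [NormedAddCommGroup E] [NormedSpace ℝ E] :
    ∃ c : ℝ, ∀ f : L2 a b E, ‖primₗ a b E f‖ ≤ c * ‖f‖ := by
  obtain ⟨c, hc, h⟩ := L2.exists_integral_norm_le a b E
  refine ⟨(measureUnivNNReal (volIoo a b) : ℝ) ^ (2 : ENNReal).toReal⁻¹ * c, fun f => ?_⟩
  rw [mul_assoc]
  refine Lp.norm_le_of_ae_bound (by positivity) ?_
  filter_upwards [coeFn_primₗ f] with t ht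
  rw [ht]
  exact (norm_primFn_le (L2.integrable f) t).trans (h f)

/-- The bounded operator on `L²(a, b; E)` taking a function to its primitive vanishing at `a`. -/
def prim (a b : ℝ) (E : Type*) [NormedAddCommGroup E] [NormedSpace ℝ E] :
    L2 a b E →L[ℝ] L2 a b E :=
  (primₗ a b E).mkContinuousOfExistsBound (primₗ_bound a b E)

theorem coeFn_prim (f : L2 a b E) : prim a b E f =ᵐ[volIoo a b] primFn a b f :=
  coeFn_primₗ f

/-- Bounded operators commute with the Bochner integral. This supplies the commutation of
integration in time with `C`, `A`, `R` and with the Riesz map. -/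
theorem prim_compLpL [CompleteSpace E] [CompleteSpace F] (L : E →L[ℝ] F) (f : L2 a b E) :
    prim a b F (L.compLpL 2 (volIoo a b) f) = L.compLpL 2 (volIoo a b) (prim a b E f) := by
  apply Lp.ext
  filter_upwards [coeFn_prim (L.compLpL 2 (volIoo a b) f), coeFn_prim f,
    L.coeFn_compLpL (prim a b E f)] with t h1 h2 h3
  rw [h1, h3, h2, primFn_congr (L.coeFn_compLpL f)]
  exact L.integral_comp_comm (L2.integrable f).integrableOn

/-- Fubini's theorem on the triangle `{s ≤ t}`. -/
theorem integral_bilin_primFn [CompleteSpace E] [CompleteSpace F] [CompleteSpace G]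
    (B : E →L[ℝ] F →L[ℝ] G) {f : ℝ → E} {g : ℝ → F}
    (hf : Integrable f (volIoo a b)) (hg : Integrable g (volIoo a b)) :
    ∫ t in Ioo a b, B (primFn a b f t) (g t)
      = ∫ s in Ioo a b, B (f s) (∫ t in Ici s, g t ∂volIoo a b) := by
  have hint : Integrable (Function.uncurry fun t s => (Iic t).indicator (fun s => B (f s) (g t)) s)
      ((volIoo a b).prod (volIoo a b)) := by
    have h : Integrable (fun z : ℝ × ℝ => B.flip (g z.1) (f z.2))
        ((volIoo a b).prod (volIoo a b)) :=
      Integrable.op_fst_snd (op := fun x y => B.flip x y) (by fun_prop)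
        ⟨‖B.flip‖, fun x y => B.flip.le_opNorm₂ x y⟩ hg hf
    refine (h.indicator (s := {z : ℝ × ℝ | z.2 ≤ z.1})
      (measurableSet_le measurable_snd measurable_fst)).congr (Filter.Eventually.of_forall ?_)
    rintro ⟨t, s⟩
    by_cases hst : s ≤ t <;> simp [indicator, hst]
  have key := integral_integral_swap hint
  calc ∫ t in Ioo a b, B (primFn a b f t) (g t)
      = ∫ t in Ioo a b, ∫ s in Ioo a b, (Iic t).indicator (fun s => B (f s) (g t)) s := by
        refine integral_congr_ae (Filter.Eventually.of_forall fun t => ?_)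
        simp only
        rw [integral_indicator measurableSet_Iic]
        exact ((B.flip (g t)).integral_comp_comm hf.integrableOn).symm
    _ = ∫ s in Ioo a b, ∫ t in Ioo a b, (Iic t).indicator (fun s => B (f s) (g t)) s := key
    _ = _ := by
        refine integral_congr_ae (Filter.Eventually.of_forall fun s => ?_)
        have : (fun t => (Iic t).indicator (fun s => B (f s) (g t)) s)
            = (Ici s).indicator fun t => B (f s) (g t) := by
          funext t
          by_cases hst : s ≤ t <;> simp [indicator, hst]
        simp only
        rw [this, integral_indicator measurableSet_Ici]
        exact (B (f s)).integral_comp_comm hg.integrableOn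

end Primitive

/-! ### Positivity of time integration against a symmetric nonnegative operator -/

section Positivity

variable {E : Type*} [NormedAddCommGroup E] [InnerProductSpace ℝ E] [CompleteSpace E] {a b : ℝ}

/-- With `F` the primitive of `f`, the integrand `(C f, F)` is formally the derivative of `(C F, F)
/ 2`, so the pairing equals `(C m, m) / 2` with `m = ∫ f`. Fubini replaces the differentiation. -/
theorem inner_prim_nonneg (C : E →L[ℝ] E) (hsymm : ∀ x y, inner ℝ (C x) y = inner ℝ x (C y))
    (hpos : ∀ x, 0 ≤ inner ℝ (C x) x) (f : L2 a b E) :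
    0 ≤ inner ℝ (C.compLpL 2 (volIoo a b) f) (prim a b E f) := by
  let B : E →L[ℝ] E →L[ℝ] ℝ := LinearMap.mkContinuous₂
    (LinearMap.mk₂ ℝ (fun x y : E => inner ℝ x (C y)) (fun _ _ _ => inner_add_left _ _ _)
      (fun _ _ _ => real_inner_smul_left _ _ _) (fun x y z => by rw [map_add, inner_add_right])
      (fun c x y => by rw [map_smul, real_inner_smul_right]; rfl)) ‖C‖ fun x y => by
      calc ‖inner ℝ x (C y)‖ ≤ ‖x‖ * ‖C y‖ := norm_inner_le_norm _ _
        _ ≤ ‖x‖ * (‖C‖ * ‖y‖) := by gcongr; exact C.le_opNorm y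
        _ = _ := by ring
  have hB : ∀ x y, B x y = inner ℝ x (C y) := fun _ _ => rfl
  have hf := L2.integrable f
  set m : E := ∫ s in Ioo a b, f s
  have hpf : Integrable (primFn a b f) (volIoo a b) := (memLp_primFn hf).integrable (by norm_num)
  have hC : Integrable (fun t => B (primFn a b f t) (f t)) (volIoo a b) := by
    refine (L2.integrable_inner (prim a b E f) (C.compLpL 2 (volIoo a b) f)).congr ?_
    filter_upwards [coeFn_prim f, C.coeFn_compLpL f] with t h1 h2
    rw [h1, h2, hB]
  have h1 : inner ℝ (C.compLpL 2 (volIoo a b) f) (prim a b E f)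
      = ∫ t in Ioo a b, B (primFn a b f t) (f t) := by
    rw [L2.inner_def]
    refine integral_congr_ae ?_
    filter_upwards [coeFn_prim f, C.coeFn_compLpL f] with t h1 h2
    rw [h1, h2, hB, real_inner_comm]
  have h2 : ∀ s, ∫ t in Ici s, f t ∂volIoo a b = m - primFn a b f s := fun s => by
    rw [integral_Ici_eq_integral_Ioi, eq_sub_iff_add_eq, add_comm, primFn, ← compl_Iic]
    exact integral_add_compl measurableSet_Iic hf
  -- After the swap the inner integral is `m` minus the primitive, and symmetry of `C` returns the
  -- original integral with a minus sign. The integral is therefore half of `B m m`.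
  have h3 : ∫ t in Ioo a b, B (primFn a b f t) (f t)
      = B m m - ∫ t in Ioo a b, B (primFn a b f t) (f t) := by
    conv_lhs => rw [integral_bilin_primFn B hf hf]
    have : ∀ s, B (f s) (∫ t in Ici s, f t ∂volIoo a b)
        = B.flip m (f s) - B (primFn a b f s) (f s) := fun s => by
      rw [h2, map_sub, ContinuousLinearMap.flip_apply]
      congr 1
      rw [hB, hB, ← hsymm, real_inner_comm]
    simp_rw [this]
    rw [integral_sub ((B.flip m).integrable_comp hf) hC, (B.flip m).integral_comp_comm hf]
    rfl
  have h4 : 0 ≤ B m m := by rw [hB, real_inner_comm]; exact hpos m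
  linarith

end Positivity

/-! ### Weak derivatives and end values of primitives; du Bois-Reymond -/

section WeakDerivPrim

variable {E : Type*} [NormedAddCommGroup E] [NormedSpace ℝ E] {a b : ℝ}

theorem integral_Ici_deriv {φ : ℝ → ℝ} (h1 : ContDiff ℝ ∞ φ)
    (h3 : tsupport φ ⊆ Ioo a b) {s : ℝ} (hs : s ∈ Ioo a b) :
    ∫ t in Ici s, deriv φ t ∂volIoo a b = - φ s := by
  have hb : φ b = 0 := by
    by_contra h
    exact lt_irrefl b (h3 (subset_tsupport φ h)).2
  rw [volIoo, Measure.restrict_restrict measurableSet_Ici]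
  have : Ici s ∩ Ioo a b = Ico s b := by
    ext x
    simp only [mem_inter_iff, mem_Ici, mem_Ioo, mem_Ico]
    exact ⟨fun h => ⟨h.1, h.2.2⟩, fun h => ⟨h.1, hs.1.trans_le h.1, h.2⟩⟩
  rw [this, integral_Ico_eq_integral_Ioc, ← intervalIntegral.integral_of_le hs.2.le,
    intervalIntegral.integral_deriv_eq_sub
      (fun x _ => (h1.differentiable (by norm_num)).differentiableAt)
      ((h1.continuous_deriv (by norm_num)).intervalIntegrable _ _), hb, zero_sub]

theorem hasWeakDeriv_prim [CompleteSpace E] (f : L2 a b E) :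
    HasWeakDeriv a b (prim a b E f) f := by
  intro φ h1 h2 h3
  have hφ : Continuous (deriv φ) := h1.continuous_deriv (by norm_num)
  have hint : Integrable (deriv φ) (volIoo a b) :=
    (hφ.integrable_of_hasCompactSupport h2.deriv).restrict
  have key := integral_bilin_primFn (ContinuousLinearMap.lsmul ℝ ℝ (E := E)).flip
    (L2.integrable f) hint
  simp only [ContinuousLinearMap.flip_apply, ContinuousLinearMap.lsmul_apply] at key
  calc ∫ x in Ioo a b, deriv φ x • prim a b E f x
      = ∫ t in Ioo a b, deriv φ t • primFn a b f t := by
        refine integral_congr_ae ?_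
        filter_upwards [coeFn_prim f] with t ht
        rw [ht]
    _ = ∫ s in Ioo a b, (∫ t in Ici s, deriv φ t ∂volIoo a b) • f s := key
    _ = ∫ s in Ioo a b, -(φ s • f s) := by
        refine setIntegral_congr_fun measurableSet_Ioo fun s hs => ?_
        rw [integral_Ici_deriv h1 h3 hs, neg_smul]
    _ = _ := integral_neg _

theorem hasValueAt_prim (f : L2 a b E) : HasValueAt a b (prim a b E f) a 0 :=
  ⟨primFn a b f, (continuous_primFn (L2.integrable f)).continuousOn, coeFn_prim f, primFn_left _⟩

theorem hasValueAt_prim_right (f : L2 a b E) :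
    HasValueAt a b (prim a b E f) b (∫ s in Ioo a b, f s) :=
  ⟨primFn a b f, (continuous_primFn (L2.integrable f)).continuousOn, coeFn_prim f, primFn_right _⟩

/-- The value at a point of `[a, b]` of the continuous representative is unique. -/
theorem HasValueAt.unique {E : Type*} [NormedAddCommGroup E] {a b : ℝ} (hab : a < b) {f : ℝ → E} {x : ℝ} (hx : x ∈ Icc a b) {c d : E}
    (hc : HasValueAt a b f x c) (hd : HasValueAt a b f x d) : c = d := by
  obtain ⟨f₀, h1, h2, rfl⟩ := hc
  obtain ⟨g₀, k1, k2, rfl⟩ := hd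
  have h : f₀ =ᵐ[volume.restrict (Icc a b)] g₀ := by
    rw [← restrict_Ioo_eq_restrict_Icc]
    exact h2.symm.trans k2
  exact Measure.eqOn_Icc_of_ae_eq volume hab.ne h h1 k1 hx

theorem HasValueAt.valueAt_eq {E : Type*} [NormedAddCommGroup E] {a b : ℝ} (hab : a < b) {f : ℝ → E} {x : ℝ} (hx : x ∈ Icc a b) {c : E}
    (hc : HasValueAt a b f x c) : valueAt a b f x = c :=
  HasValueAt.unique hab hx (Classical.epsilon_spec (p := fun c => HasValueAt a b f x c) ⟨c, hc⟩) hc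

/-- A test function with integral zero is the derivative of a test function. -/
theorem exists_testFunction_deriv_eq (hab : a < b) {η : ℝ → ℝ} (h1 : ContDiff ℝ ∞ η)
    (h2 : HasCompactSupport η) (h3 : tsupport η ⊆ Ioo a b) (h0 : ∫ x, η x = 0) :
    ∃ φ : ℝ → ℝ, ContDiff ℝ ∞ φ ∧ HasCompactSupport φ ∧ tsupport φ ⊆ Ioo a b ∧ deriv φ = η := by
  obtain ⟨c, hc⟩ : (Ioo a b).Nonempty := nonempty_Ioo.2 hab
  -- The extra point `c` keeps `K` nonempty when `η` is zero, so that the extreme points `l` and `r`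
  -- always exist.
  set K : Set ℝ := insert c (tsupport η)
  have hK : IsCompact K := IsCompact.insert h2 c
  have hKab : K ⊆ Ioo a b := insert_subset hc h3
  have hKne : K.Nonempty := ⟨c, mem_insert _ _⟩
  obtain ⟨l, hl, hl'⟩ := hK.exists_isLeast hKne
  obtain ⟨r, hr, hr'⟩ := hK.exists_isGreatest hKne
  have hη : ∀ x, x ∉ Icc l r → η x = 0 := fun x hx => by
    by_contra h
    have : x ∈ K := mem_insert_of_mem _ (subset_tsupport η h)
    exact hx ⟨hl' this, hr' this⟩
  have hint : Integrable η := h1.continuous.integrable_of_hasCompactSupport h2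
  set φ : ℝ → ℝ := fun x => ∫ t in l..x, η t
  have hder : ∀ x, HasDerivAt φ (η x) x := fun x =>
    intervalIntegral.integral_hasDerivAt_right hint.intervalIntegrable
      (h1.continuous.stronglyMeasurableAtFilter _ _) h1.continuous.continuousAt
  have hderiv : deriv φ = η := funext fun x => (hder x).deriv
  have hsupp : Function.support φ ⊆ Icc l r := by
    intro x hx
    by_contra hx'
    refine hx ?_
    rcases lt_or_ge x l with h | h
    · refine intervalIntegral.integral_zero_ae ?_
      -- The interval of integration contains its endpoint `l`, where `η` is not known to vanish; a
      -- single point is negligible.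
      have hne : ∀ᵐ t : ℝ, t ≠ l := by simp [ae_iff]
      filter_upwards [hne] with t htl ht
      rw [uIoc_of_ge h.le] at ht
      exact hη t fun h' => htl (le_antisymm ht.2 h'.1)
    · have hrx : r < x := by
        by_contra h'
        exact hx' ⟨h, not_lt.1 h'⟩
      have h4 : ∫ t in l..x, η t = ∫ t, η t := by
        rw [intervalIntegral.integral_of_le h, ← integral_Icc_eq_integral_Ioc]
        refine setIntegral_eq_integral_of_forall_compl_eq_zero fun t ht => hη t fun h' => ht ?_
        exact ⟨h'.1, h'.2.trans hrx.le⟩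
      exact h4.trans h0
  have hts : tsupport φ ⊆ Icc l r := closure_minimal hsupp isClosed_Icc
  refine ⟨φ, ?_, HasCompactSupport.of_support_subset_isCompact isCompact_Icc hsupp,
    hts.trans fun x hx => ⟨(hKab hl).1.trans_le hx.1, hx.2.trans_lt (hKab hr).2⟩, hderiv⟩
  rw [contDiff_infty_iff_deriv, hderiv]
  exact ⟨fun x => (hder x).differentiableAt, h1⟩

/-- The lemma of du Bois-Reymond. -/
theorem ae_eq_const_of_integral_deriv_smul_eq_zero [CompleteSpace E] (hab : a < b) {h : ℝ → E}
    (hh : Integrable h (volIoo a b))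
    (hz : ∀ φ : ℝ → ℝ, ContDiff ℝ ∞ φ → HasCompactSupport φ → tsupport φ ⊆ Ioo a b →
      ∫ x in Ioo a b, deriv φ x • h x = 0) :
    ∃ c, h =ᵐ[volIoo a b] fun _ => c := by
  -- Outer radius `(b - a) / 4` about the midpoint keeps the closed support inside the open
  -- interval. The constant sought is the mean of `h` weighted by the normalized bump.
  let β : ContDiffBump ((a + b) / 2) := ⟨(b - a) / 8, (b - a) / 4, by linarith, by linarith⟩
  set χ : ℝ → ℝ := β.normed volume
  have hχ1 : ContDiff ℝ ∞ χ := β.contDiff_normed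
  have hχ2 : HasCompactSupport χ := β.hasCompactSupport_normed
  have hχ3 : tsupport χ ⊆ Ioo a b := by
    rw [β.tsupport_normed_eq, Real.closedBall_eq_Icc]
    intro x hx
    have h1 : β.rOut = (b - a) / 4 := rfl
    rw [h1] at hx
    exact ⟨by linarith [hx.1], by linarith [hx.2]⟩
  have hχ0 : ∫ x, χ x = 1 := β.integral_normed
  have hsm : ∀ ψ : ℝ → ℝ, Continuous ψ → HasCompactSupport ψ →
      Integrable (fun x => ψ x • h x) (volIoo a b) := fun ψ hψ hψ2 => by
    obtain ⟨C, hC⟩ := hψ2.exists_bound_of_continuous hψ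
    exact hh.bdd_smul C hψ.aestronglyMeasurable (Filter.Eventually.of_forall hC)
  set c : E := ∫ x in Ioo a b, χ x • h x
  refine ⟨c, ?_⟩
  have key : ∀ᵐ x, x ∈ Ioo a b → h x - c = 0 := by
    refine isOpen_Ioo.ae_eq_zero_of_integral_contDiff_smul_eq_zero
      (IntegrableOn.locallyIntegrableOn (hh.sub (integrable_const c))) fun ψ h1 h2 h3 => ?_
    have hψi : Integrable ψ := h1.continuous.integrable_of_hasCompactSupport h2
    have hχi : Integrable χ := hχ1.continuous.integrable_of_hasCompactSupport hχ2
    set m : ℝ := ∫ x, ψ x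
    have hψm : ∫ x in Ioo a b, ψ x = m :=
      setIntegral_eq_integral_of_forall_compl_eq_zero fun x hx => by
        by_contra h'
        exact hx (h3 (subset_tsupport ψ h'))
    -- Subtracting `m • χ` makes the integral of an arbitrary test function zero, hence makes it the
    -- derivative of a test function, to which `hz` applies.
    obtain ⟨φ, p1, p2, p3, p4⟩ := exists_testFunction_deriv_eq hab (η := ψ - m • χ)
      (h1.sub (hχ1.const_smul m)) (h2.sub (hχ2.smul_left (f := fun _ => m)))
      ((tsupport_sub _ _).trans (union_subset h3
        ((tsupport_smul_subset_right (fun _ => m) χ).trans hχ3)))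
      (by
        simp only [Pi.sub_apply, Pi.smul_apply, smul_eq_mul]
        rw [integral_sub hψi (hχi.const_mul m), integral_const_mul, hχ0, mul_one, sub_self])
    have hz' := hz φ p1 p2 p3
    rw [p4] at hz'
    have e1 : ∫ x in Ioo a b, (ψ - m • χ) x • h x
        = (∫ x in Ioo a b, ψ x • h x) - m • c := by
      have hmχ : Integrable (fun x => m • χ x • h x) (volIoo a b) :=
        (hsm χ hχ1.continuous hχ2).smul m
      rw [← integral_smul, ← integral_sub (hsm ψ h1.continuous h2) hmχ]
      refine integral_congr_ae (Filter.Eventually.of_forall fun x => ?_)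
      simp only [Pi.sub_apply, Pi.smul_apply, smul_eq_mul, sub_smul, mul_smul]
    have e2 : ∫ x in Ioo a b, ψ x • (h x - c) = (∫ x in Ioo a b, ψ x • h x) - m • c := by
      rw [← hψm, ← integral_smul_const, ← integral_sub (hsm ψ h1.continuous h2)
        (hψi.restrict.smul_const c)]
      simp only [smul_sub]
    rw [← hz', e1, ← e2]
    refine (setIntegral_eq_integral_of_forall_compl_eq_zero fun x hx => ?_).symm
    have : ψ x = 0 := by
      by_contra h'
      exact hx (h3 (subset_tsupport ψ h'))
    rw [this, zero_smul]
  rw [Filter.EventuallyEq, ae_restrict_iff' measurableSet_Ioo]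
  filter_upwards [key] with x hx hx'
  exact sub_eq_zero.1 (hx hx')

/-- `f` has the weak derivative `f'` and vanishes at `a` iff it is the primitive of `f'`. -/
theorem hasWeakDeriv_and_hasValueAt_iff [CompleteSpace E] (hab : a < b) (f f' : L2 a b E) :
    HasWeakDeriv a b f f' ∧ HasValueAt a b f a 0 ↔ f = prim a b E f' := by
  refine ⟨fun ⟨h1, h2⟩ => ?_, fun h => h ▸ ⟨hasWeakDeriv_prim f', hasValueAt_prim f'⟩⟩
  set d : L2 a b E := f + (-1 : ℝ) • prim a b E f'
  have hd : HasWeakDeriv a b d (0 : L2 a b E) := by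
    have h := h1.add ((hasWeakDeriv_prim f').smul (-1))
    have e : f' + (-1 : ℝ) • f' = 0 := by simp
    rw [e] at h
    exact h
  have hd0 : HasValueAt a b d a 0 := by
    have h := h2.add ((hasValueAt_prim f').smul (-1))
    rwa [smul_zero, add_zero] at h
  obtain ⟨c, hc⟩ := ae_eq_const_of_integral_deriv_smul_eq_zero hab (L2.integrable d)
    -- The difference `d` has weak derivative zero, so it is constant; its value at `a` shows that
    -- the constant is zero.
    fun φ p1 p2 p3 => by rw [hd φ p1 p2 p3, integral_smul_zero, neg_zero]
  have hdc : HasValueAt a b d a c := ⟨fun _ => c, continuousOn_const, hc, rfl⟩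
  have hc0 : c = 0 := HasValueAt.unique hab (left_mem_Icc.2 hab.le) hdc hd0
  have hzero : d = 0 := by
    apply Lp.ext
    filter_upwards [hc, Lp.coeFn_zero E 2 (volIoo a b)] with x hx h0
    rw [hx, h0, hc0, Pi.zero_apply]
  have : f - prim a b E f' = 0 := by
    rw [← hzero, sub_eq_add_neg, ← neg_one_smul ℝ (prim a b E f')]
  exact sub_eq_zero.1 this

end WeakDerivPrim

/-! ### The abstract time-integrated equation in a Hilbert space -/

section OperatorEquation

variable {X : Type*} [NormedAddCommGroup X] [InnerProductSpace ℝ X]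

/-- If `‖S η‖ ≤ c ‖Q† η‖` for all `η`, then the range of `S†` is contained in that of `Q`. -/
theorem exists_apply_eq_of_adjoint_bound [CompleteSpace X] (Q S : X →L[ℝ] X) (c : ℝ)
    (h : ∀ η, ‖S.adjoint η‖ ≤ c * ‖Q.adjoint η‖) (f : X) : ∃ w, Q w = S f := by
  let P : X →ₗ[ℝ] X := Q.adjoint.toLinearMap
  -- The functional wanted on the range of `Q†` is `Q† η ↦ ⟨f, S† η⟩`. The section `s` chooses `η`
  -- linearly; by the bound `h` the choice does not affect `S† η` (see `hη`), and the functional is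
  -- bounded. The Riesz representative of its Hahn-Banach extension solves the equation.
  obtain ⟨s, hs⟩ := P.rangeRestrict.exists_rightInverse_of_surjective P.range_rangeRestrict
  have hs' : ∀ y : P.range, Q.adjoint (s y) = y := fun y =>
    congrArg Subtype.val (LinearMap.congr_fun hs y)
  let L : P.range →ₗ[ℝ] ℝ :=
    (innerSL ℝ f).toLinearMap ∘ₗ S.adjoint.toLinearMap ∘ₗ s
  have hL : ∀ y, L y = inner ℝ f (S.adjoint (s y)) := fun _ => rfl
  obtain ⟨g, hg, -⟩ := exists_extension_norm_eq P.range (L.mkContinuous (‖f‖ * c) fun y => by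
    calc ‖L y‖ ≤ ‖f‖ * ‖S.adjoint (s y)‖ := norm_inner_le_norm _ _
      _ ≤ ‖f‖ * (c * ‖Q.adjoint (s y)‖) := by gcongr; exact h _
      _ = ‖f‖ * c * ‖y‖ := by rw [hs', mul_assoc]; rfl)
  refine ⟨(InnerProductSpace.toDual ℝ X).symm g, ext_inner_right ℝ fun η => ?_⟩
  have hη : S.adjoint (s (P.rangeRestrict η)) = S.adjoint η := by
    rw [← sub_eq_zero, ← map_sub, ← norm_le_zero_iff]
    refine (h _).trans_eq ?_
    rw [map_sub, hs']
    simp [P]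
  calc inner ℝ (Q ((InnerProductSpace.toDual ℝ X).symm g)) η
      = inner ℝ ((InnerProductSpace.toDual ℝ X).symm g) (Q.adjoint η) :=
        (ContinuousLinearMap.adjoint_inner_right _ _ _).symm
    _ = g (P.rangeRestrict η : X) := InnerProductSpace.toDual_symm_apply
    _ = inner ℝ f (S.adjoint η) := by rw [hg, LinearMap.mkContinuous_apply, hL, hη]
    _ = inner ℝ (S f) η := ContinuousLinearMap.adjoint_inner_right _ _ _

/-- Data for the abstract equation `C w + I A w + I R I w = I f` in a Hilbert space, where `I` plays
the role of integration in time. -/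
structure IsDampedSystem (I C A R : X →L[ℝ] X) (α : ℝ) : Prop where
  α_pos : 0 < α
  coercive : ∀ x, α * ‖x‖ ^ 2 ≤ inner ℝ (A x) x
  comm_C : ∀ x, I (C x) = C (I x)
  comm_A : ∀ x, I (A x) = A (I x)
  comm_R : ∀ x, I (R x) = R (I x)
  symm_C : ∀ x y, inner ℝ (C x) y = inner ℝ x (C y)
  symm_R : ∀ x y, inner ℝ (R x) y = inner ℝ x (R y)
  nonneg_C : ∀ x, 0 ≤ inner ℝ (C x) (I x)
  nonneg_R : ∀ x, 0 ≤ inner ℝ (R x) (I x)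

namespace IsDampedSystem

variable {I C A R : X →L[ℝ] X} {α : ℝ}

/-- The energy estimate: pair the equation with `I w`. The inertia and stiffness terms are
nonnegative, and the damping term is at least `α ‖I w‖²`. -/
theorem norm_le (hS : IsDampedSystem I C A R α) {f w : X}
    (h : C w + I (A w) + I (R (I w)) = I f) : α * ‖I w‖ ≤ ‖I f‖ := by
  have h1 : inner ℝ (C w) (I w) + inner ℝ (A (I w)) (I w) + inner ℝ (R (I w)) (I (I w))
      = inner ℝ (I f) (I w) := by
    rw [← h, inner_add_left, inner_add_left, hS.comm_A, hS.comm_R, hS.symm_R (I (I w)),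
      real_inner_comm (R (I w))]
  have h2 := hS.nonneg_C w
  have h3 := hS.coercive (I w)
  have h4 := hS.nonneg_R (I w)
  have h5 := real_inner_le_norm (I f) (I w)
  rcases (norm_nonneg (I w)).eq_or_lt with h0 | h0
  · rw [← h0, mul_zero]
    exact norm_nonneg _
  · refine le_of_mul_le_mul_right ?_ h0
    nlinarith

/-- The energy estimate for the adjoint: pairing `Q† η` with `ζ = I† η` gives the same three terms,
now with `η` or `ζ` as arguments, and hence `α ‖I† η‖ ≤ ‖Q† η‖`. -/
theorem exists_solution [CompleteSpace X] (hS : IsDampedSystem I C A R α) (f : X) :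
    ∃ w, C w + I (A w) + I (R (I w)) = I f := by
  let Q : X →L[ℝ] X := C + I ∘L A + I ∘L R ∘L I
  have hQ : ∀ w, Q w = C w + I (A w) + I (R (I w)) := fun _ => rfl
  refine exists_apply_eq_of_adjoint_bound Q I α⁻¹ (fun η => ?_) f
  set ζ := I.adjoint η with hζ
  have h1 : inner ℝ (Q.adjoint η) ζ
      = inner ℝ (C η) (I η) + inner ℝ (A ζ) ζ + inner ℝ (R ζ) (I ζ) := by
    rw [ContinuousLinearMap.adjoint_inner_left, hQ, inner_add_right, inner_add_right,
      ← ContinuousLinearMap.adjoint_inner_left I, ← ContinuousLinearMap.adjoint_inner_left I, ← hζ,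
      ← hS.symm_C, ← hS.symm_R, hζ, ContinuousLinearMap.adjoint_inner_right, hS.comm_C,
      hS.symm_C, real_inner_comm, real_inner_comm (I.adjoint η)]
  have h2 := hS.nonneg_C η
  have h3 := hS.coercive ζ
  have h4 := hS.nonneg_R ζ
  have h5 := real_inner_le_norm (Q.adjoint η) ζ
  rw [← div_eq_inv_mul, le_div_iff₀ hS.α_pos]
  rcases (norm_nonneg ζ).eq_or_lt with h0 | h0
  · rw [← h0, zero_mul]
    exact norm_nonneg _
  · refine le_of_mul_le_mul_right ?_ h0
    nlinarith

/-- The abstract problem is uniquely solvable with a bounded linear solution operator. -/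
theorem exists_solutionOperator [CompleteSpace X] (hS : IsDampedSystem I C A R α) :
    ∃ Ψ : X →L[ℝ] X, ∀ f u, (∃ w, u = I w ∧ C w + I (A w) + I (R u) = I f) ↔ u = Ψ f := by
  -- The energy estimate controls only `I w`, so it is `u = I w` that is shown to be unique. This
  -- suffices to make `f ↦ I (W f)` linear for an arbitrary choice `W`.
  have huniq : ∀ {w w' f}, C w + I (A w) + I (R (I w)) = I f →
      C w' + I (A w') + I (R (I w')) = I f → I w = I w' := fun {w w' f} h h' => by
    have := hS.norm_le (f := 0) (w := w - w') (by
      simp only [map_sub, map_zero]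
      rw [← sub_eq_zero] at h
      rw [← h'] at h
      rw [← h]
      abel)
    rw [map_zero, norm_zero] at this
    have h0 : ‖I (w - w')‖ ≤ 0 := by
      by_contra hn
      exact absurd this (not_le.2 (mul_pos hS.α_pos (not_le.1 hn)))
    rwa [norm_le_zero_iff, map_sub, sub_eq_zero] at h0
  choose W hW using hS.exists_solution
  let Ψ : X →ₗ[ℝ] X :=
    { toFun := fun f => I (W f)
      map_add' := fun f g => by
        rw [← map_add]
        refine huniq (hW (f + g)) ?_
        rw [map_add I f g, ← hW f, ← hW g]
        simp only [map_add]
        abel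
      map_smul' := fun c f => by
        rw [RingHom.id_apply, ← map_smul]
        refine huniq (hW (c • f)) ?_
        rw [map_smul I c f, ← hW f]
        simp only [map_smul, smul_add] }
  refine ⟨Ψ.mkContinuous (α⁻¹ * ‖I‖) fun f => ?_, fun f u => ⟨?_, ?_⟩⟩
  · rw [mul_assoc, ← div_eq_inv_mul, le_div_iff₀ hS.α_pos, mul_comm]
    exact (hS.norm_le (hW f)).trans (I.le_opNorm f)
  · rintro ⟨w, rfl, h⟩
    exact huniq h (hW f)
  · rintro rfl
    exact ⟨W f, rfl, hW f⟩

end IsDampedSystem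

end OperatorEquation

/-! ### Least squares over a bounded closed convex set -/

section Minimization

variable {X Y : Type*} [NormedAddCommGroup X] [InnerProductSpace ℝ X] [CompleteSpace X]
  [NormedAddCommGroup Y] [NormedSpace ℝ Y]

/-- A decreasing sequence of nonempty bounded closed convex sets in a Hilbert space has a common
point. -/
theorem nonempty_iInter_of_convex {K : ℕ → Set X} (hanti : Antitone K)
    (hne : ∀ n, (K n).Nonempty) (hcl : ∀ n, IsClosed (K n)) (hconv : ∀ n, Convex ℝ (K n))
    {M : ℝ} (hM : ∀ n, ∀ x ∈ K n, ‖x‖ ≤ M) : (⋂ n, K n).Nonempty := by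
  -- The points of least norm in the `K n` form a Cauchy sequence, whose limit lies in every `K n`.
  -- This takes the place of weak compactness.
  have hmin : ∀ n, ∃ x ∈ K n, ∀ y ∈ K n, ‖x‖ ≤ ‖y‖ := fun n => by
    obtain ⟨x, hx, h⟩ := exists_norm_eq_iInf_of_complete_convex (hne n) (hcl n).isComplete
      (hconv n) 0
    refine ⟨x, hx, fun y hy => ?_⟩
    have h' : (⨅ w : K n, ‖(0 : X) - w‖) ≤ ‖(0 : X) - y‖ :=
      ciInf_le ⟨0, by rintro _ ⟨w, rfl⟩; exact norm_nonneg _⟩ (⟨y, hy⟩ : K n)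
    rw [← h] at h'
    simpa using h'
  choose x hx hxmin using hmin
  set d : ℕ → ℝ := fun n => ‖x n‖ ^ 2
  have hdm : Monotone d := fun n m hnm =>
    pow_le_pow_left₀ (norm_nonneg _) (hxmin n _ (hanti hnm (hx m))) 2
  have hdb : BddAbove (range d) := ⟨M ^ 2, by
    rintro _ ⟨n, rfl⟩
    exact pow_le_pow_left₀ (norm_nonneg _) (hM n _ (hx n)) 2⟩
  have hdlim := tendsto_atTop_ciSup hdm hdb
  set D := ⨆ n, d n
  have hdD : ∀ n, d n ≤ D := le_ciSup hdb
  -- The midpoint of `x n` and `x m` lies in `K n`, so its norm is at least `‖x n‖`; the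
  -- parallelogram law then leaves at most `2 (d m - d n)`.
  have hdist : ∀ n m, n ≤ m → ‖x n - x m‖ ^ 2 ≤ 2 * (D - d n) := fun n m hnm => by
    have hmid : (2⁻¹ : ℝ) • x n + (2⁻¹ : ℝ) • x m ∈ K n :=
      hconv n (hx n) (hanti hnm (hx m)) (by norm_num) (by norm_num) (by norm_num)
    have h1 := hxmin n _ hmid
    rw [← smul_add, norm_smul, norm_inv, Real.norm_ofNat] at h1
    have h2 := parallelogram_law_with_norm ℝ (x n) (x m)
    have h3 := hdD m
    have h4 := norm_nonneg (x n)
    simp only [d] at h3 ⊢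
    nlinarith
  have hcauchy : CauchySeq x := by
    rw [Metric.cauchySeq_iff']
    intro ε hε
    have hev : ∀ᶠ n in Filter.atTop, D - ε ^ 2 / 2 < d n :=
      hdlim.eventually_const_lt (by have := pow_pos hε 2; linarith)
    obtain ⟨N, hN⟩ := hev.exists
    refine ⟨N, fun n hn => ?_⟩
    rw [dist_comm, dist_eq_norm]
    refine lt_of_pow_lt_pow_left₀ 2 hε.le ?_
    have := hdist N n hn
    linarith
  obtain ⟨z, hz⟩ := cauchySeq_tendsto_of_complete hcauchy
  refine ⟨z, mem_iInter.2 fun n => (hcl n).mem_of_tendsto hz ?_⟩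
  filter_upwards [Filter.eventually_ge_atTop n] with m hm using hanti hm (hx m)

/-- A least squares problem over a nonempty bounded closed convex set has a solution. -/
theorem exists_isMinOn_norm_sub {K : Set X} (hne : K.Nonempty) (hcl : IsClosed K)
    (hconv : Convex ℝ K) {M : ℝ} (hM : ∀ x ∈ K, ‖x‖ ≤ M) (L : X →L[ℝ] Y) (y : Y) :
    ∃ x ∈ K, IsMinOn (fun x => ‖L x - y‖) K x := by
  set m : ℝ := sInf ((fun x => ‖L x - y‖) '' K)
  have hbdd : BddBelow ((fun x => ‖L x - y‖) '' K) := ⟨0, by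
    rintro _ ⟨x, -, rfl⟩
    exact norm_nonneg _⟩
  -- A common point of these near-optimal sublevel sets attains the infimum `m`.
  let S : ℕ → Set X := fun n => K ∩ {x | ‖L x - y‖ ≤ m + 1 / ((n : ℝ) + 1)}
  have hfun : ConvexOn ℝ K fun x => ‖L x - y‖ := by
    refine ⟨hconv, fun x _ z _ s t hs ht hst => ?_⟩
    have : L (s • x + t • z) - y = s • (L x - y) + t • (L z - y) := by
      have h1 : y = (s + t) • y := by rw [hst, one_smul]
      conv_lhs => rw [h1]
      rw [map_add, map_smul, map_smul]
      module
    simp only [this]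
    refine (norm_add_le _ _).trans_eq ?_
    rw [norm_smul, norm_smul, Real.norm_of_nonneg hs, Real.norm_of_nonneg ht]
    rfl
  obtain ⟨x, hx⟩ : (⋂ n, S n).Nonempty := by
    refine nonempty_iInter_of_convex (fun n k hnk x hx => ⟨hx.1, le_trans (b := m + 1 / ((k : ℝ) + 1)) hx.2 ?_⟩) (fun n => ?_)
      (fun n => hcl.inter (isClosed_le (by fun_prop) continuous_const)) (fun n => ?_)
      (M := M) (fun n x hx => hM x hx.1)
    · gcongr
    · obtain ⟨_, ⟨x, hx, rfl⟩, h⟩ := exists_lt_of_csInf_lt (hne.image _)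
        (show m < m + 1 / ((n : ℝ) + 1) from lt_add_of_pos_right _ (by positivity))
      exact ⟨x, hx, h.le⟩
    · exact hfun.convex_le _
  rw [mem_iInter] at hx
  refine ⟨x, (hx 0).1, fun z hz => ?_⟩
  have h1 : ‖L x - y‖ ≤ m := by
    refine ge_of_tendsto' (x := Filter.atTop) (f := fun n : ℕ => m + 1 / ((n : ℝ) + 1)) ?_ fun n => (hx n).2
    simpa using tendsto_one_div_add_atTop_nhds_zero_nat.const_add m
  exact h1.trans (csInf_le hbdd ⟨z, hz, rfl⟩)

end Minimization

/-! ### Pointwise operators acting on `L²(a, b; E)` -/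

section Lift

variable {E : Type*} [NormedAddCommGroup E] [InnerProductSpace ℝ E] {a b : ℝ}

theorem inner_compLpL_symm {C : E →L[ℝ] E} (h : ∀ x y, inner ℝ (C x) y = inner ℝ x (C y))
    (f g : L2 a b E) : inner ℝ (C.compLpL 2 (volIoo a b) f) g
      = inner ℝ f (C.compLpL 2 (volIoo a b) g) := by
  rw [L2.inner_def, L2.inner_def]
  refine integral_congr_ae ?_
  filter_upwards [C.coeFn_compLpL f, C.coeFn_compLpL g] with t h1 h2
  rw [h1, h2, h]

theorem inner_compLpL_coercive {A : E →L[ℝ] E} {α : ℝ} (h : ∀ x, α * ‖x‖ ^ 2 ≤ inner ℝ (A x) x)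
    (f : L2 a b E) : α * ‖f‖ ^ 2 ≤ inner ℝ (A.compLpL 2 (volIoo a b) f) f := by
  rw [← real_inner_self_eq_norm_sq, L2.inner_def, L2.inner_def, ← integral_const_mul]
  refine integral_mono_ae ((L2.integrable_inner f f).const_mul α) (L2.integrable_inner _ f) ?_
  filter_upwards [A.coeFn_compLpL f] with t h1
  rw [h1, real_inner_self_eq_norm_sq]
  exact h _

/-- Only the damping operator must be coercive. For inertia and stiffness, symmetry and
nonnegativity suffice, through `inner_prim_nonneg`. -/
theorem isDampedSystem_compLpL [CompleteSpace E] {C A R : E →L[ℝ] E} {α : ℝ} (hα : 0 < α)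
    (hA : ∀ x, α * ‖x‖ ^ 2 ≤ inner ℝ (A x) x)
    (hC : ∀ x y, inner ℝ (C x) y = inner ℝ x (C y)) (hC0 : ∀ x, 0 ≤ inner ℝ (C x) x)
    (hR : ∀ x y, inner ℝ (R x) y = inner ℝ x (R y)) (hR0 : ∀ x, 0 ≤ inner ℝ (R x) x) :
    IsDampedSystem (prim a b E) (C.compLpL 2 (volIoo a b)) (A.compLpL 2 (volIoo a b))
      (R.compLpL 2 (volIoo a b)) α where
  α_pos := hα
  coercive := inner_compLpL_coercive hA
  comm_C := prim_compLpL C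
  comm_A := prim_compLpL A
  comm_R := prim_compLpL R
  symm_C := inner_compLpL_symm hC
  symm_R := inner_compLpL_symm hR
  nonneg_C := inner_prim_nonneg C hC hC0
  nonneg_R := inner_prim_nonneg R hR hR0

end Lift

/-! ### The weak formulation as an integrated equation -/

/-- The Riesz map of a real inner product space as an `ℝ`-linear map. -/
def rieszL (E : Type*) [NormedAddCommGroup E] [InnerProductSpace ℝ E] :
    E →L[ℝ] StrongDual ℝ E :=
  (innerₗ E).mkContinuous₂ 1 fun x y => by
    rw [one_mul]
    exact norm_inner_le_norm x y

theorem rieszL_apply {E : Type*} [NormedAddCommGroup E] [InnerProductSpace ℝ E] (x y : E) :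
    rieszL E x y = inner ℝ x y := rfl

theorem rieszL_injective (E : Type*) [NormedAddCommGroup E] [InnerProductSpace ℝ E] :
    Function.Injective (rieszL E) := fun x y h =>
  ext_inner_right ℝ fun v => by rw [← rieszL_apply, h, rieszL_apply]

theorem compLpL_injective {E F : Type*} [NormedAddCommGroup E] [NormedSpace ℝ E]
    [NormedAddCommGroup F] [NormedSpace ℝ F] {a b : ℝ} {L : E →L[ℝ] F}
    (hL : Function.Injective L) : Function.Injective (L.compLpL 2 (volIoo a b)) := fun f g h => by
  apply Lp.ext
  filter_upwards [L.coeFn_compLpL f, L.coeFn_compLpL g] with t h1 h2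
  apply hL
  rw [← h1, ← h2, h]

/-- The weak formulation of `(C u')' + A u' + R u = f` with zero initial data, integrated in time. -/
theorem weakFormulation_iff {E : Type*} [NormedAddCommGroup E] [InnerProductSpace ℝ E]
    [CompleteSpace E] {a b : ℝ} (hab : a < b) (C A R : E →L[ℝ] E) (f u : L2 a b E) :
    (∃ (w : L2 a b E) (p p' : L2 a b (StrongDual ℝ E)),
      HasWeakDeriv a b u w ∧ HasValueAt a b u a 0 ∧
      (∀ᵐ t ∂volIoo a b, ∀ v, p t v = inner ℝ (C (w t)) v) ∧
      HasWeakDeriv a b p p' ∧ HasValueAt a b p a 0 ∧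
      ∀ᵐ t ∂volIoo a b, ∀ v,
        p' t v + (inner ℝ (A (w t)) v + inner ℝ (R (u t)) v) = inner ℝ (f t) v) ↔
    ∃ w, u = prim a b E w ∧ C.compLpL 2 (volIoo a b) w
        + prim a b E (A.compLpL 2 (volIoo a b) w) + prim a b E (R.compLpL 2 (volIoo a b) u)
      = prim a b E f := by
  set D := rieszL E
  constructor
  · rintro ⟨w, p, p', hw, hu0, hp, hpp', hp0, heq⟩
    have hu := (hasWeakDeriv_and_hasValueAt_iff hab u w).1 ⟨hw, hu0⟩
    have hprim := (hasWeakDeriv_and_hasValueAt_iff hab p p').1 ⟨hpp', hp0⟩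
    refine ⟨w, hu, ?_⟩
    set C' := C.compLpL 2 (volIoo a b) w
    set A' := A.compLpL 2 (volIoo a b) w
    set R' := R.compLpL 2 (volIoo a b) u
    -- The tested identities determine both `p` and `p'` as Riesz images, so `p = prim p'` becomes
    -- an equation in `E` once the injective Riesz map is removed.
    have e1 : p = D.compLpL 2 (volIoo a b) C' := by
      apply Lp.ext
      filter_upwards [hp, D.coeFn_compLpL C', C.coeFn_compLpL w] with t h1 h2 h3
      ext v
      rw [h1, h2, rieszL_apply, h3]
    have e2 : p' = D.compLpL 2 (volIoo a b) (f - (A' + R')) := by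
      apply Lp.ext
      filter_upwards [heq, D.coeFn_compLpL (f - (A' + R')), Lp.coeFn_sub f (A' + R'),
        Lp.coeFn_add A' R', A.coeFn_compLpL w, R.coeFn_compLpL u] with t h1 h2 h3 h4 h5 h6
      ext v
      rw [h2, rieszL_apply, h3, Pi.sub_apply, h4, Pi.add_apply, h5, h6, inner_sub_left,
        inner_add_left, ← h1 v]
      ring
    rw [e1, e2, prim_compLpL] at hprim
    rw [compLpL_injective (rieszL_injective E) hprim, map_sub, map_add]
    abel
  · rintro ⟨w, hu, h⟩
    obtain ⟨hw, hu0⟩ := (hasWeakDeriv_and_hasValueAt_iff hab u w).2 hu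
    set C' := C.compLpL 2 (volIoo a b) w
    set A' := A.compLpL 2 (volIoo a b) w
    set R' := R.compLpL 2 (volIoo a b) u
    have hC : C' = prim a b E (f - (A' + R')) := by
      rw [map_sub, map_add, ← h]
      abel
    -- The witnesses are the Riesz images of `C w` and of `f - (A w + R u)`; the integrated equation
    -- says that the first is the primitive of the second.
    obtain ⟨hpp', hp0⟩ := (hasWeakDeriv_and_hasValueAt_iff hab
      (D.compLpL 2 (volIoo a b) C') (D.compLpL 2 (volIoo a b) (f - (A' + R')))).2
      (by rw [prim_compLpL, ← hC])
    refine ⟨w, _, _, hw, hu0, ?_, hpp', hp0, ?_⟩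
    · filter_upwards [D.coeFn_compLpL C', C.coeFn_compLpL w] with t h2 h3
      intro v
      rw [h2, rieszL_apply, h3]
    · filter_upwards [D.coeFn_compLpL (f - (A' + R')), Lp.coeFn_sub f (A' + R'),
        Lp.coeFn_add A' R', A.coeFn_compLpL w, R.coeFn_compLpL u] with t h2 h3 h4 h5 h6
      intro v
      rw [h2, rieszL_apply, h3, Pi.sub_apply, h4, Pi.add_apply, h5, h6, inner_sub_left,
        inner_add_left]
      ring

/-- The integral as a bounded functional on `L²(a, b)`. -/
def integralL (a b : ℝ) : L2 a b ℝ →L[ℝ] ℝ :=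
  LinearMap.mkContinuousOfExistsBound
    { toFun := fun f => ∫ x in Ioo a b, f x
      map_add' := fun f g => by
        rw [← integral_add (L2.integrable f) (L2.integrable g)]
        exact integral_congr_ae (Lp.coeFn_add f g)
      map_smul' := fun c f => by
        rw [RingHom.id_apply, ← integral_smul]
        exact integral_congr_ae (Lp.coeFn_smul c f) } <| by
    obtain ⟨c, -, hc⟩ := L2.exists_integral_norm_le a b ℝ
    exact ⟨c, fun f => (norm_integral_le_integral_norm _).trans (hc f)⟩

/-! ### Operators of weighted `L²` forms -/

section Coefficient

variable {a b : ℝ} {c : ℝ → ℝ}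

/-- Multiplication by an essentially bounded coefficient. -/
def mulL (hc : MemLp c ⊤ (volIoo a b)) : L2 a b ℝ →L[ℝ] L2 a b ℝ :=
  (ContinuousLinearMap.mul ℝ ℝ).holderL (volIoo a b) ⊤ 2 2 hc.toLp

theorem coeFn_mulL (hc : MemLp c ⊤ (volIoo a b)) (f : L2 a b ℝ) :
    mulL hc f =ᵐ[volIoo a b] fun x => c x * f x := by
  filter_upwards [(ContinuousLinearMap.mul ℝ ℝ).coeFn_holder (r := 2) hc.toLp f, hc.coeFn_toLp]
    with x h1 h2
  rw [← h2]
  exact h1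

theorem inner_mulL (hc : MemLp c ⊤ (volIoo a b)) (f g : L2 a b ℝ) :
    inner ℝ (mulL hc f) g = ∫ x in Ioo a b, c x * f x * g x := by
  rw [L2.inner_def]
  refine integral_congr_ae ?_
  filter_upwards [coeFn_mulL hc f] with x h
  rw [h, real_inner_comm]
  rfl

theorem integrable_mul_mul (hc : MemLp c ⊤ (volIoo a b)) (f g : L2 a b ℝ) :
    Integrable (fun x => c x * f x * g x) (volIoo a b) := by
  refine (L2.integrable_inner (mulL hc f) g).congr ?_
  filter_upwards [coeFn_mulL hc f] with x h
  rw [h, real_inner_comm]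
  rfl

theorem le_inner_mulL (hc : MemLp c ⊤ (volIoo a b)) {c₀ : ℝ} (h : ∀ᵐ x ∂volIoo a b, c₀ ≤ c x)
    (f : L2 a b ℝ) : c₀ * ‖f‖ ^ 2 ≤ inner ℝ (mulL hc f) f := by
  rw [inner_mulL, ← real_inner_self_eq_norm_sq, L2.inner_def, ← integral_const_mul]
  refine integral_mono_ae ((L2.integrable_inner f f).const_mul c₀) (integrable_mul_mul hc f f) ?_
  filter_upwards [h] with x hx
  rw [real_inner_self_eq_norm_sq, Real.norm_eq_abs, sq_abs, mul_assoc, ← sq]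
  exact mul_le_mul_of_nonneg_right hx (sq_nonneg _)

variable {H : Type*} [NormedAddCommGroup H] [InnerProductSpace ℝ H] [CompleteSpace H]

/-- The operator on `H` representing the form `(x, y) ↦ ∫ c (L x) (L y)`. -/
def formOp (hc : MemLp c ⊤ (volIoo a b)) (L : H →L[ℝ] L2 a b ℝ) : H →L[ℝ] H :=
  L.adjoint ∘L mulL hc ∘L L

theorem inner_formOp (hc : MemLp c ⊤ (volIoo a b)) (L : H →L[ℝ] L2 a b ℝ) (x y : H) :
    inner ℝ (formOp hc L x) y = ∫ s in Ioo a b, c s * L x s * L y s := by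
  rw [formOp, ContinuousLinearMap.comp_apply, ContinuousLinearMap.comp_apply,
    ContinuousLinearMap.adjoint_inner_left, inner_mulL]

theorem le_inner_formOp (hc : MemLp c ⊤ (volIoo a b)) {c₀ : ℝ}
    (h : ∀ᵐ x ∂volIoo a b, c₀ ≤ c x) (L : H →L[ℝ] L2 a b ℝ) (x : H) :
    c₀ * ‖L x‖ ^ 2 ≤ inner ℝ (formOp hc L x) x := by
  rw [inner_formOp, ← inner_mulL]
  exact le_inner_mulL hc h _

theorem inner_formOp_nonneg (hc : MemLp c ⊤ (volIoo a b)) (h : ∀ᵐ x ∂volIoo a b, 0 ≤ c x)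
    (L : H →L[ℝ] L2 a b ℝ) (x : H) : 0 ≤ inner ℝ (formOp hc L x) x := by
  simpa using le_inner_formOp hc h L x

theorem inner_formOp_symm (hc : MemLp c ⊤ (volIoo a b)) (L : H →L[ℝ] L2 a b ℝ) (x y : H) :
    inner ℝ (formOp hc L x) y = inner ℝ x (formOp hc L y) := by
  rw [real_inner_comm _ x, inner_formOp, inner_formOp]
  simp only [mul_right_comm]

end Coefficient

/-! ### The clamped energy space -/

section EnergySpace

variable {ℓ : ℝ}

/-- The clamped conditions turn each weak derivative relation into a primitive, so `v_xx` determines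
`v`. Completeness, the formulas for the tip values and the Poincaré inequality all follow from this
description. -/
theorem mem_clampedH2_iff (hℓ : 0 < ℓ) (p : PiLp 2 fun _ : Fin 3 => L2 0 ℓ ℝ) :
    p ∈ clampedH2 ℓ ↔ p 0 = prim 0 ℓ ℝ (p 1) ∧ p 1 = prim 0 ℓ ℝ (p 2) := by
  rw [← hasWeakDeriv_and_hasValueAt_iff hℓ, ← hasWeakDeriv_and_hasValueAt_iff hℓ]
  exact ⟨fun ⟨⟨h1, h2⟩, h3, h4⟩ => ⟨⟨h1, h3⟩, h2, h4⟩, fun ⟨⟨h1, h3⟩, h2, h4⟩ => ⟨⟨h1, h2⟩, h3, h4⟩⟩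

/-- The primitive relations are closed conditions, since `prim` is bounded. Completeness is needed
for adjoints and Riesz representatives on `V`. -/
theorem completeSpace_V (hℓ : 0 < ℓ) : CompleteSpace (V ℓ) := by
  have h : IsClosed (clampedH2 ℓ : Set (PiLp 2 fun _ : Fin 3 => L2 0 ℓ ℝ)) := by
    have : (clampedH2 ℓ : Set (PiLp 2 fun _ : Fin 3 => L2 0 ℓ ℝ))
        = {p | p 0 = prim 0 ℓ ℝ (p 1)} ∩ {p | p 1 = prim 0 ℓ ℝ (p 2)} := by
      ext p
      exact mem_clampedH2_iff hℓ p
    rw [this]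
    exact (isClosed_eq (by fun_prop) (by fun_prop)).inter
      (isClosed_eq (by fun_prop) (by fun_prop))
  exact h.completeSpace_coe

namespace V

/-- The `i`-th derivative, as a bounded operator on the energy space. -/
def derivL (ℓ : ℝ) (i : Fin 3) : V ℓ →L[ℝ] L2 0 ℓ ℝ :=
  PiLp.proj 2 (fun _ : Fin 3 => L2 0 ℓ ℝ) i ∘L (clampedH2 ℓ).subtypeL

theorem fn_eq_derivL (v : V ℓ) : v.fn = derivL ℓ 0 v := rfl

theorem dxx_eq_derivL (v : V ℓ) : v.dxx = derivL ℓ 2 v := rfl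

theorem tip_eq (hℓ : 0 < ℓ) (v : V ℓ) : v.tip = integralL 0 ℓ (derivL ℓ 1 v) := by
  refine HasValueAt.valueAt_eq hℓ (right_mem_Icc.2 hℓ.le) ?_
  have h : v.fn = prim 0 ℓ ℝ v.dx := ((mem_clampedH2_iff hℓ v.1).1 v.2).1
  rw [h]
  exact hasValueAt_prim_right v.dx

theorem tipSlope_eq (hℓ : 0 < ℓ) (v : V ℓ) : v.tipSlope = integralL 0 ℓ (derivL ℓ 2 v) := by
  refine HasValueAt.valueAt_eq hℓ (right_mem_Icc.2 hℓ.le) ?_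
  have h : v.dx = prim 0 ℓ ℝ v.dxx := ((mem_clampedH2_iff hℓ v.1).1 v.2).2
  rw [h]
  exact hasValueAt_prim_right v.dxx

/-- The Poincaré inequality in the energy space. -/
theorem exists_norm_sq_le (hℓ : 0 < ℓ) :
    ∃ c : ℝ, 0 < c ∧ ∀ v : V ℓ, ‖v‖ ^ 2 ≤ c * ‖derivL ℓ 2 v‖ ^ 2 := by
  set P := prim 0 ℓ ℝ
  -- The three summands bound `v`, `v_x` and `v_xx`, with `v = P (P v_xx)` and `v_x = P v_xx`.
  refine ⟨‖P‖ ^ 4 + ‖P‖ ^ 2 + 1, by positivity, fun v => ?_⟩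
  obtain ⟨h0, h1⟩ := (mem_clampedH2_iff hℓ v.1).1 v.2
  have e : ‖v‖ ^ 2 = ‖v.1 0‖ ^ 2 + ‖v.1 1‖ ^ 2 + ‖v.1 2‖ ^ 2 := by
    rw [← Fin.sum_univ_three (fun i => ‖v.1 i‖ ^ 2), ← PiLp.norm_sq_eq_of_L2]
    rfl
  have hb1 : ‖v.1 1‖ ≤ ‖P‖ * ‖v.1 2‖ := by
    rw [h1]
    exact P.le_opNorm _
  have hb0 : ‖v.1 0‖ ≤ ‖P‖ * ‖v.1 1‖ := by
    rw [h0]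
    exact P.le_opNorm _
  have hb0' : ‖v.1 0‖ ≤ ‖P‖ ^ 2 * ‖v.1 2‖ := by
    refine hb0.trans ?_
    rw [sq, mul_assoc]
    gcongr
  have s1 := pow_le_pow_left₀ (norm_nonneg _) hb1 2
  have s0 := pow_le_pow_left₀ (norm_nonneg _) hb0' 2
  rw [e]
  change _ ≤ _ * ‖v.1 2‖ ^ 2
  linear_combination s0 + s1

end V

end EnergySpace

/-! ### The beam problem, its output operator and quasi-solutions -/

namespace Model

variable {B : Model}

section WeakSolution

variable [CompleteSpace (V B.ℓ)]

/-- The operator of the form `∫ ρ_A v w`. -/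
def inertiaOp (hB : B.BasicConditions) : V B.ℓ →L[ℝ] V B.ℓ :=
  formOp hB.ρA_mem (V.derivL B.ℓ 0)

/-- The operator of the form `∫ μ v w + ∫ κ v_xx w_xx`. -/
def dampingOp (hB : B.BasicConditions) : V B.ℓ →L[ℝ] V B.ℓ :=
  formOp hB.μ_mem (V.derivL B.ℓ 0) + formOp hB.κ_mem (V.derivL B.ℓ 2)

/-- The operator of the form `∫ r v_xx w_xx`. -/
def stiffnessOp (hB : B.BasicConditions) : V B.ℓ →L[ℝ] V B.ℓ :=
  formOp hB.r_mem (V.derivL B.ℓ 2)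

/-- The Riesz representative of the load `v ↦ (2 h cos θ / π) v_x(ℓ) + v(ℓ)`. -/
def load (B : Model) [CompleteSpace (V B.ℓ)] : V B.ℓ :=
  (InnerProductSpace.toDual ℝ (V B.ℓ)).symm
    ((2 * B.h * Real.cos B.θ / Real.pi) • (integralL 0 B.ℓ ∘L V.derivL B.ℓ 2)
      + integralL 0 B.ℓ ∘L V.derivL B.ℓ 1)

/-- The forcing term generated by a shear force. -/
def forcing (B : Model) [CompleteSpace (V B.ℓ)] : L2 0 B.T ℝ →L[ℝ] L2 0 B.T (V B.ℓ) :=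
  (ContinuousLinearMap.toSpanSingleton ℝ B.load).compLpL 2 (volIoo 0 B.T)

theorem inner_inertiaOp (hB : B.BasicConditions) (x v : V B.ℓ) :
    inner ℝ (inertiaOp hB x) v = ∫ s in Ioo 0 B.ℓ, B.ρA s * x.fn s * v.fn s :=
  inner_formOp hB.ρA_mem (V.derivL B.ℓ 0) x v

theorem inner_damping_add_stiffness (hB : B.BasicConditions) (x y v : V B.ℓ) :
    inner ℝ (dampingOp hB x) v + inner ℝ (stiffnessOp hB y) v
      = (∫ s in Ioo 0 B.ℓ, B.μ s * x.fn s * v.fn s)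
        + ∫ s in Ioo 0 B.ℓ, (B.r s * y.dxx s + B.κ s * x.dxx s) * v.dxx s := by
  have h : ∫ s in Ioo 0 B.ℓ, (B.r s * y.dxx s + B.κ s * x.dxx s) * v.dxx s
      = (∫ s in Ioo 0 B.ℓ, B.r s * y.dxx s * v.dxx s)
        + ∫ s in Ioo 0 B.ℓ, B.κ s * x.dxx s * v.dxx s := by
    rw [← integral_add (integrable_mul_mul hB.r_mem y.dxx v.dxx)
      (integrable_mul_mul hB.κ_mem x.dxx v.dxx)]
    simp only [add_mul]
  rw [h, dampingOp, stiffnessOp, add_apply, inner_add_left, inner_formOp,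
    inner_formOp, inner_formOp]
  simp only [V.fn_eq_derivL, V.dxx_eq_derivL]
  ring

/-- Because the moment is a multiple of the shear force, both boundary terms at the tip are `g t`
times one fixed functional on `V`. This makes the forcing linear in `g`. -/
theorem smul_inner_load (hB : B.BasicConditions) (g : ℝ → ℝ) (t : ℝ) (v : V B.ℓ) :
    inner ℝ (g t • B.load) v = B.moment g t * v.tipSlope + g t * v.tip := by
  refine (real_inner_smul_left B.load v (g t)).trans ?_
  rw [load, InnerProductSpace.toDual_symm_apply, V.tip_eq hB.ℓ_pos,
    V.tipSlope_eq hB.ℓ_pos, moment]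
  simp only [add_apply, smul_apply,
    ContinuousLinearMap.comp_apply, smul_eq_mul]
  ring

theorem coeFn_forcing (g : L2 0 B.T ℝ) :
    B.forcing g =ᵐ[volIoo 0 B.T] fun t => g t • B.load :=
  (ContinuousLinearMap.toSpanSingleton ℝ B.load).coeFn_compLpL g

theorem isWeakSolution_iff (hB : B.BasicConditions) (g : L2 0 B.T ℝ) (u : L2 0 B.T (V B.ℓ)) :
    B.IsWeakSolution g u ↔ ∃ w, u = prim 0 B.T (V B.ℓ) w ∧
      (inertiaOp hB).compLpL 2 (volIoo 0 B.T) w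
        + prim 0 B.T (V B.ℓ) ((dampingOp hB).compLpL 2 (volIoo 0 B.T) w)
        + prim 0 B.T (V B.ℓ) ((stiffnessOp hB).compLpL 2 (volIoo 0 B.T) u)
      = prim 0 B.T (V B.ℓ) (B.forcing g) := by
  rw [← weakFormulation_iff hB.T_pos, IsWeakSolution]
  refine exists_congr fun w => exists_congr fun p => exists_congr fun p' =>
    and_congr_right fun _ => and_congr_right fun _ => and_congr ?_
      (and_congr_right fun _ => and_congr_right fun _ => ?_)
  · simp only [inner_inertiaOp]
  · refine Filter.eventually_congr ?_
    filter_upwards [coeFn_forcing g] with t ht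
    refine forall_congr' fun v => ?_
    rw [ht, smul_inner_load hB g, inner_damping_add_stiffness, add_assoc]

/-- Coercivity comes from the `κ` term and the Poincaré inequality alone; the `μ` term is only
nonnegative. -/
theorem exists_dampingOp_coercive (hB : B.BasicConditions) :
    ∃ α : ℝ, 0 < α ∧ ∀ x, α * ‖x‖ ^ 2 ≤ inner ℝ (dampingOp hB x) x := by
  obtain ⟨c, hc, hP⟩ := V.exists_norm_sq_le hB.ℓ_pos
  obtain ⟨κ₀, _, hκ₀, hκ⟩ := hB.κ_bounds
  obtain ⟨μ₀, _, hμ₀, hμ⟩ := hB.μ_bounds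
  refine ⟨κ₀ / c, by positivity, fun x => ?_⟩
  have h1 := inner_formOp_nonneg hB.μ_mem (hμ.mono fun s hs => hμ₀.trans hs.1) (V.derivL B.ℓ 0) x
  have h2 := le_inner_formOp hB.κ_mem (hκ.mono fun s hs => hs.1) (V.derivL B.ℓ 2) x
  have h3 : κ₀ / c * ‖x‖ ^ 2 ≤ κ₀ * ‖V.derivL B.ℓ 2 x‖ ^ 2 := by
    rw [div_mul_eq_mul_div, div_le_iff₀ hc, mul_assoc, mul_comm _ c]
    exact mul_le_mul_of_nonneg_left (hP x) hκ₀.le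
  rw [dampingOp, add_apply, inner_add_left]
  linarith

end WeakSolution

/-- The direct problem is uniquely solvable, with a bounded linear solution operator on `L²`. -/
theorem exists_solutionOperator (hB : B.BasicConditions) :
    ∃ Φ : L2 0 B.T ℝ →L[ℝ] L2 0 B.T (V B.ℓ), ∀ (g : L2 0 B.T ℝ) u,
      B.IsWeakSolution g u ↔ u = Φ g := by
  have := completeSpace_V hB.ℓ_pos
  obtain ⟨α, hα, hA⟩ := exists_dampingOp_coercive hB
  obtain ⟨ρ₀, _, hρ₀, hρ⟩ := hB.ρA_bounds
  obtain ⟨r₀, _, hr₀, hr⟩ := hB.r_bounds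
  obtain ⟨Ψ, hΨ⟩ := (isDampedSystem_compLpL (a := 0) (b := B.T) (C := inertiaOp hB)
    (A := dampingOp hB) (R := stiffnessOp hB) hα hA (inner_formOp_symm _ _)
    (inner_formOp_nonneg _ (hρ.mono fun s hs => hρ₀.le.trans hs.1) _) (inner_formOp_symm _ _)
    (inner_formOp_nonneg _ (hr.mono fun s hs => hr₀.le.trans hs.1) _)).exists_solutionOperator
  exact ⟨Ψ ∘L B.forcing, fun g u => (isWeakSolution_iff hB g u).trans (hΨ _ _)⟩

/-- The output is given by a bounded linear operator on `L²`. -/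
theorem exists_outputOperator (hB : B.BasicConditions) :
    ∃ Λ : L2 0 B.T ℝ →L[ℝ] L2 0 B.T ℝ, ∀ g : H1 0 B.T,
      B.output g =ᵐ[volIoo 0 B.T] Λ g.1.fst := by
  obtain ⟨Φ, hΦ⟩ := exists_solutionOperator hB
  let τ : V B.ℓ →L[ℝ] ℝ := integralL 0 B.ℓ ∘L V.derivL B.ℓ 1
  refine ⟨τ.compLpL 2 (volIoo 0 B.T) ∘L Φ, fun g => ?_⟩
  -- A weak solution exists, so the choice in `solution` returns one, and by uniqueness it is `Φ g`.
  have h : B.solution g = Φ g.1.fst :=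
    (hΦ _ _).1 (Classical.epsilon_spec (p := fun u => B.IsWeakSolution g.1.fst u)
      ⟨_, (hΦ _ _).2 rfl⟩)
  filter_upwards [τ.coeFn_compLpL (Φ g.1.fst)] with t ht
  rw [ContinuousLinearMap.comp_apply, ht, output, h, V.tip_eq hB.ℓ_pos]
  rfl

theorem J_eq {Λ : L2 0 B.T ℝ →L[ℝ] L2 0 B.T ℝ} {g : H1 0 B.T}
    (h : B.output g =ᵐ[volIoo 0 B.T] Λ g.1.fst) (ν : L2 0 B.T ℝ) :
    B.J ν g = 1 / 2 * ‖Λ g.1.fst - ν‖ ^ 2 := by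
  rw [J, ← real_inner_self_eq_norm_sq, L2.inner_def]
  congr 1
  refine integral_congr_ae ?_
  filter_upwards [h, Lp.coeFn_sub (Λ g.1.fst) ν] with t h1 h2
  rw [h1, h2, real_inner_self_eq_norm_sq, Real.norm_eq_abs, sq_abs, Pi.sub_apply]

theorem exists_isQuasiSolution (hB : B.BasicConditions) {Cg : ℝ} (hCg : 0 < Cg)
    (ν : L2 0 B.T ℝ) : ∃ g, B.IsQuasiSolution Cg ν g := by
  obtain ⟨Λ, hΛ⟩ := exists_outputOperator hB
  set P := prim 0 B.T ℝ
  -- The map `d ↦ (P d, d)` parametrizes by `d = g'` the functions `g` in `H¹` with `g(0) = 0`. The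
  -- minimization then takes place in `L²(0, T)`, over the preimage `K` of the ball of radius `Cg`.
  let N : L2 0 B.T ℝ →L[ℝ] WithLp 2 (L2 0 B.T ℝ × L2 0 B.T ℝ) :=
    (WithLp.prodContinuousLinearEquiv 2 ℝ (L2 0 B.T ℝ) (L2 0 B.T ℝ)).symm.toContinuousLinearMap ∘L
      P.prod (ContinuousLinearMap.id ℝ _)
  have hNsnd : ∀ d, (N d).snd = d := fun _ => rfl
  have hNfst : ∀ d, (N d).fst = P d := fun _ => rfl
  have hN : ∀ d, N d ∈ H1 0 B.T := fun d => hasWeakDeriv_prim d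
  set K : Set (L2 0 B.T ℝ) := N ⁻¹' Metric.closedBall 0 Cg
  have hKmem : ∀ d, d ∈ K ↔ ‖N d‖ ≤ Cg := fun d => mem_closedBall_zero_iff
  have hbound : ∀ d ∈ K, ‖d‖ ≤ Cg := fun d hd => by
    refine le_trans ?_ ((hKmem d).1 hd)
    have h := WithLp.prod_norm_sq_eq_of_L2 (N d)
    rw [hNsnd] at h
    refine le_of_sq_le_sq ?_ (norm_nonneg _)
    rw [h]
    exact le_add_of_nonneg_left (sq_nonneg _)
  obtain ⟨d, hd, hmin⟩ := exists_isMinOn_norm_sub (K := K)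
    ⟨0, (hKmem 0).2 (by rw [map_zero, norm_zero]; exact hCg.le)⟩
    (Metric.isClosed_closedBall.preimage N.continuous)
    ((convex_closedBall 0 Cg).linear_preimage N.toLinearMap) hbound (Λ ∘L P) ν
  refine ⟨⟨N d, hN d⟩, ⟨hasValueAt_prim d, (hKmem d).1 hd⟩, fun g hg => ?_⟩
  have hg1 : g.1.fst = P g.1.snd := (hasWeakDeriv_and_hasValueAt_iff hB.T_pos _ _).1 ⟨g.2, hg.1⟩
  have hgN : N g.1.snd = g.1 := by
    refine (WithLp.equiv 2 _).injective (Prod.ext ?_ rfl)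
    exact hg1.symm
  have hgK : g.1.snd ∈ K := (hKmem _).2 (by rw [hgN]; exact hg.2)
  have h := hmin hgK
  simp only [mem_ofPred_eq, ContinuousLinearMap.comp_apply] at h ⊢
  rw [J_eq (hΛ _), J_eq (hΛ g), hg1]
  rw [hNfst]
  gcongr

end Model

end AFM

end

/-- For every admissible shear force the direct problem has exactly one weak solution and its output
lies in `L²(0, T)` (so that `J` is well defined on `𝒢`), and a quasi-solution exists. -/
theorem theorem2 (B : AFM.Model) (hB : B.BasicConditions) (Cg : ℝ) (hCg : 0 < Cg)
    (ν : AFM.L2 0 B.T ℝ) :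
    (∀ g ∈ B.admissible Cg, (∃! u, B.IsWeakSolution g.1.fst u) ∧
      MeasureTheory.MemLp (B.output g) 2 (AFM.volIoo 0 B.T)) ∧
    ∃ g, B.IsQuasiSolution Cg ν g := by
  refine ⟨fun g _ => ⟨?_, ?_⟩, AFM.Model.exists_isQuasiSolution hB hCg ν⟩
  · obtain ⟨Φ, hΦ⟩ := AFM.Model.exists_solutionOperator hB
    exact ⟨Φ g.1.fst, (hΦ _ _).2 rfl, fun u hu => (hΦ _ _).1 hu⟩
  · obtain ⟨Λ, hΛ⟩ := AFM.Model.exists_outputOperator hB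
    exact (MeasureTheory.memLp_congr_ae (hΛ g)).2 (MeasureTheory.Lp.memLp _)
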